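/- Let $K$ be a field of characteristic $\neq 2$ and let $f$ be a nondegenerate isotropic quadratic form on a $K$-vector space $W$ of dimension $n\ge 5$, with associated symmetric bilinear form $(\cdot\mid\cdot)$, $(x\mid x)=f(x)$. Let $e_1,\dots,e_n$ be a basis of $W$ and $\alpha_3,\dots,\alpha_n\in K$ such that $$f(x_1e_1+\cdots+x_ne_n)=x_1x_2+\alpha_3x_3^2+\cdots+\alpha_nx_n^2,$$ and put $a=e_n$, $b=e_{n-1}$. Let $G=\mathbf{Spin}_n(f)$, acting on the quadratic space through its vector representation $w\mapsto gwg^{-1}$ (in the Clifford algebra of $f$), and let $G(w)$ denote the stabilizer of a vector $w$ in $G$. Let $P=G(a)\times G(b)\times G(a)\times G(b)$, and let $Z$ be the variety of triples $(g,s,t)$ with $g\in G$ and $s,t$ in the quadratic space such that $$f(s)=f(a),\quad (s\mid g(b))=0,\quad (t\mid a)=0,\quad f(t)=f(b),\quad (s\mid t)=0.$$ Define the morphisms $\mu\colon P\to G$, $\mu(x,y,z,u)=xyzu$; $\varphi\colon P\to Z$, $\varphi(x,y,z,u)=(xyzu,\,xy(a),\,xy(b))$; and $\psi\colon Z\to G$,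 $\psi(g,s,t)=g$, so that $\mu=\psi\circ\varphi$. A subscript $K$ denotes $K$-rational points. Then: (i) for every $g\in G_K$, $\psi^{-1}(g)_K\neq\emptyset$; (ii) for every $\zeta\in Z_K$, $\varphi^{-1}(\zeta)_K\neq\emptyset$. Consequently $\mu(P_K)=G_K$, that is, $G_K=G(a)_K\,G(b)_K\,G(a)_K\,G(b)_K$. -/

import Mathlib

open scoped Pointwise

noncomputable section

namespace SpinDecomposition

section Field

variable {K : Type*} [Field K] [Invertible (2 : K)] {W : Type*} [AddCommGroup W] [Module K W]

theorem ι_injective (f : QuadraticForm K W) : Function.Injective (CliffordAlgebra.ι f) := by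
  intro v w h
  have h2 := congrArg (CliffordAlgebra.equivExterior f) h
  have key : ∀ m : W, CliffordAlgebra.equivExterior f (CliffordAlgebra.ι f m) =
      ExteriorAlgebra.ι K m := fun m =>
    CliffordAlgebra.changeForm_ι CliffordAlgebra.changeForm.associated_neg_proof m
  rw [key, key] at h2
  exact (ExteriorAlgebra.ι_inj K v w).1 h2

theorem conj_mem_range_ι (f : QuadraticForm K W) (g : spinGroup f) (w : W) :
    (g : CliffordAlgebra f) * CliffordAlgebra.ι f w * ((g⁻¹ : spinGroup f) : CliffordAlgebra f) ∈
      LinearMap.range (CliffordAlgebra.ι f) := by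
  have h := spinGroup.conjAct_smul_ι_mem_range_ι (x := spinGroup.toUnits g)
    (by simp) w
  rw [ConjAct.units_smul_def, ConjAct.ofConjAct_toConjAct, ← map_inv] at h
  simpa using h

/-- The vector `g w g⁻¹`, where `W` is regarded as a subspace of the Clifford algebra of `f`. -/
def spinApply (f : QuadraticForm K W) (g : spinGroup f) (w : W) : W :=
  (LinearEquiv.ofInjective (CliffordAlgebra.ι f) (ι_injective f)).symm
    ⟨_, conj_mem_range_ι f g w⟩

theorem ι_spinApply (f : QuadraticForm K W) (g : spinGroup f) (w : W) :
    CliffordAlgebra.ι f (spinApply f g w) =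
      (g : CliffordAlgebra f) * CliffordAlgebra.ι f w *
        ((g⁻¹ : spinGroup f) : CliffordAlgebra f) := by
  have h := (LinearEquiv.ofInjective (CliffordAlgebra.ι f) (ι_injective f)).apply_symm_apply
    ⟨_, conj_mem_range_ι f g w⟩
  exact congrArg Subtype.val h

/-- The natural (vector) representation of the spin group of `f` on `W`: `g` sends `w` to
`g w g⁻¹`, the product being taken in the Clifford algebra of `f`. -/
def vectorRep (f : QuadraticForm K W) : Representation K (spinGroup f) W where
  toFun g :=
    { toFun := spinApply f g
      map_add' := fun v w => ι_injective f (by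
        simp only [map_add, ι_spinApply, mul_add, add_mul])
      map_smul' := fun c w => ι_injective f (by
        simp only [map_smul, ι_spinApply, mul_smul_comm, smul_mul_assoc, RingHom.id_apply]) }
  map_one' := LinearMap.ext fun w => ι_injective f (by
    simp [ι_spinApply])
  map_mul' g h := LinearMap.ext fun w => ι_injective f (by
    simp [ι_spinApply, mul_assoc])

/-- The action of the spin group preserves the quadratic form. -/
theorem form_vectorRep (f : QuadraticForm K W) (g : spinGroup f) (w : W) :
    f (vectorRep f g w) = f w := by
  have h : CliffordAlgebra.ι f (vectorRep f g w) * CliffordAlgebra.ι f (vectorRep f g w) =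
      CliffordAlgebra.ι f w * CliffordAlgebra.ι f w := by
    have hg : ((g⁻¹ : spinGroup f) : CliffordAlgebra f) * (g : CliffordAlgebra f) = 1 := by
      rw [← Submonoid.coe_mul, inv_mul_cancel, Submonoid.coe_one]
    have hg' : (g : CliffordAlgebra f) * ((g⁻¹ : spinGroup f) : CliffordAlgebra f) = 1 := by
      rw [← Submonoid.coe_mul, mul_inv_cancel, Submonoid.coe_one]
    have e : CliffordAlgebra.ι f (vectorRep f g w) = _ := ι_spinApply f g w
    calc _ = (g : CliffordAlgebra f) * CliffordAlgebra.ι f w *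
          (((g⁻¹ : spinGroup f) : CliffordAlgebra f) * (g : CliffordAlgebra f)) *
          CliffordAlgebra.ι f w * ((g⁻¹ : spinGroup f) : CliffordAlgebra f) := by
            rw [e]; simp only [mul_assoc]
      _ = (g : CliffordAlgebra f) * (CliffordAlgebra.ι f w * CliffordAlgebra.ι f w) *
          ((g⁻¹ : spinGroup f) : CliffordAlgebra f) := by
            rw [hg]; simp only [mul_assoc, one_mul]
      _ = _ := by
            rw [CliffordAlgebra.ι_sq_scalar, ← Algebra.commutes, mul_assoc, hg', mul_one]
  rw [CliffordAlgebra.ι_sq_scalar, CliffordAlgebra.ι_sq_scalar] at h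
  exact FaithfulSMul.algebraMap_injective K (CliffordAlgebra f) h

/-- `(x | y)`: the symmetric bilinear form associated with `f`, so that `(x | x) = f x`. -/
abbrev bil (f : QuadraticForm K W) (x y : W) : K := QuadraticMap.associated f x y

theorem bil_vectorRep (f : QuadraticForm K W) (g : spinGroup f) (v w : W) :
    bil f (vectorRep f g v) (vectorRep f g w) = bil f v w := by
  simp only [bil, QuadraticMap.associated_apply, ← map_add, form_vectorRep]

/-- The stabilizer `G(w)` of a vector `w` in the spin group `G` of `f`. -/
def stab (f : QuadraticForm K W) (w : W) : Subgroup (spinGroup f) where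
  carrier := {g | vectorRep f g w = w}
  one_mem' := by simp
  mul_mem' {g h} hg hh := by
    simp only [Set.mem_ofPred_eq] at hg hh ⊢
    rw [map_mul, Module.End.mul_apply, hh, hg]
  inv_mem' {g} hg := by
    simp only [Set.mem_ofPred_eq] at hg ⊢
    conv_lhs => rw [← hg]
    rw [← Module.End.mul_apply, ← map_mul, inv_mul_cancel, map_one, Module.End.one_apply]

theorem mem_stab {f : QuadraticForm K W} {w : W} {g : spinGroup f} :
    g ∈ stab f w ↔ vectorRep f g w = w := Iff.rfl

/-! The next definitions describe the `K`-rational points of the varieties `P`, `X`, `Y`, `Z`.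
All of them are cut out of products of copies of the spin group and of the quadratic space by
equations over `K`; a `K`-rational point is a solution whose components lie in the group
`spinGroup f` of `K`-points and in the `K`-space `W`. (Points over an extension `E` of `K` are
obtained from the same definitions applied to the base change of `f` to `E`.) -/

/-- `P = G(a) × G(b) × G(a) × G(b)`. -/
abbrev P (f : QuadraticForm K W) (a b : W) : Type _ :=
  stab f a × stab f b × stab f a × stab f b

/-- `X = {s | f(s) = f(a)}`. -/
def X (f : QuadraticForm K W) (a : W) : Set W := {s | f s = f a}

/-- `Y = {(g, s) ∈ G × X | (s | g(b)) = 0}`. -/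
def Y (f : QuadraticForm K W) (a b : W) : Set (spinGroup f × W) :=
  {y | y.2 ∈ X f a ∧ bil f y.2 (vectorRep f y.1 b) = 0}

/-- `Z = {(g, s, t) ∈ Y × W | (t | a) = 0, f(t) = f(b), (s | t) = 0}`. -/
def Z (f : QuadraticForm K W) (a b : W) : Set (spinGroup f × W × W) :=
  {z | (z.1, z.2.1) ∈ Y f a b ∧ bil f z.2.2 a = 0 ∧ f z.2.2 = f b ∧ bil f z.2.1 z.2.2 = 0}

/-- The product map `μ : P → G`, `μ(x, y, z, u) = xyzu`. -/
def mu (f : QuadraticForm K W) (a b : W) (p : P f a b) : spinGroup f :=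
  (p.1 : spinGroup f) * (p.2.1 : spinGroup f) * (p.2.2.1 : spinGroup f) * (p.2.2.2 : spinGroup f)

/-- For orthogonal `a` and `b`, the triple `(xyzu, xy(a), xy(b))` lies in `Z`. -/
theorem phi_mem (f : QuadraticForm K W) (a b : W) (hab : bil f a b = 0) (p : P f a b) :
    (mu f a b p, vectorRep f ((p.1 : spinGroup f) * (p.2.1 : spinGroup f)) a,
      vectorRep f ((p.1 : spinGroup f) * (p.2.1 : spinGroup f)) b) ∈ Z f a b := by
  obtain ⟨⟨x, hx⟩, ⟨y, hy⟩, ⟨z, hz⟩, ⟨u, hu⟩⟩ := p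
  rw [mem_stab] at hx hy hz hu
  refine ⟨⟨form_vectorRep f _ a, ?_⟩, ?_, form_vectorRep f _ b, ?_⟩
  · simp only [mu]
    rw [mul_assoc (x * y) z u, map_mul _ (x * y) (z * u), Module.End.mul_apply, bil_vectorRep,
      map_mul, Module.End.mul_apply, hu]
    conv_lhs => rw [← hz]
    rw [bil_vectorRep, hab]
  · simp only
    rw [map_mul, Module.End.mul_apply, hy]
    conv_lhs => rw [← hx]
    rw [bil_vectorRep, ← hab]
    exact QuadraticMap.associated_isSymm K f b a
  · simp only
    rw [bil_vectorRep, hab]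

/-- The map `φ : P → Z`, `φ(x, y, z, u) = (xyzu, xy(a), xy(b))`. -/
def phi (f : QuadraticForm K W) (a b : W) (hab : bil f a b = 0) (p : P f a b) : Z f a b :=
  ⟨(mu f a b p, vectorRep f ((p.1 : spinGroup f) * (p.2.1 : spinGroup f)) a,
    vectorRep f ((p.1 : spinGroup f) * (p.2.1 : spinGroup f)) b), phi_mem f a b hab p⟩

/-- The map `ψ : Z → G`, `ψ(g, s, t) = g`. -/
def psi (f : QuadraticForm K W) (a b : W) (z : Z f a b) : spinGroup f := z.1.1

/-- The factorization `μ = ψ ∘ φ`. -/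
theorem mu_eq_psi_comp_phi (f : QuadraticForm K W) (a b : W) (hab : bil f a b = 0) :
    mu f a b = psi f a b ∘ phi f a b hab := rfl

/-- `f` has the shape `x₁ x₂ + α₃ x₃² + ⋯ + αₙ xₙ²` in the basis `e₁, …, eₙ`
(the indices are shifted by one in the code). -/
def IsAdaptedBasis {n : ℕ} (hn : 5 ≤ n) (f : QuadraticForm K W) (e : Module.Basis (Fin n) K W)
    (α : Fin n → K) : Prop :=
  ∀ x : Fin n → K, f (∑ i, x i • e i) =
    x ⟨0, by omega⟩ * x ⟨1, by omega⟩ +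
      ∑ i ∈ Finset.univ.filter (fun i : Fin n => 2 ≤ i.val), α i * x i ^ 2

/-- The last basis vector `a = eₙ`. -/
def vecA {n : ℕ} (hn : 5 ≤ n) (e : Module.Basis (Fin n) K W) : W := e ⟨n - 1, by omega⟩

/-- The last but one basis vector `b = eₙ₋₁`. -/
def vecB {n : ℕ} (hn : 5 ≤ n) (e : Module.Basis (Fin n) K W) : W := e ⟨n - 2, by omega⟩

theorem IsAdaptedBasis.ortho {n : ℕ} {hn : 5 ≤ n} {f : QuadraticForm K W}
    {e : Module.Basis (Fin n) K W} {α : Fin n → K} (h : IsAdaptedBasis hn f e α) :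
    bil f (vecA hn e) (vecB hn e) = 0 := by
  have hA := h (Pi.single ⟨n - 1, by omega⟩ 1)
  have hB := h (Pi.single ⟨n - 2, by omega⟩ 1)
  have hAB := h (Pi.single ⟨n - 1, by omega⟩ 1 + Pi.single ⟨n - 2, by omega⟩ 1)
  have n0 : n - 1 ≠ 0 := by omega
  have n1 : n - 1 ≠ 1 := by omega
  have n2 : n - 2 ≠ 0 := by omega
  have n3 : n - 2 ≠ 1 := by omega
  have key : ∀ i : Fin n,
      ((Pi.single ⟨n - 1, by omega⟩ 1 : Fin n → K) i +
          (Pi.single ⟨n - 2, by omega⟩ 1 : Fin n → K) i) ^ 2 =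
        ((Pi.single ⟨n - 1, by omega⟩ 1 : Fin n → K) i) ^ 2 +
          ((Pi.single ⟨n - 2, by omega⟩ 1 : Fin n → K) i) ^ 2 := by
    intro i
    by_cases h1 : i = ⟨n - 1, by omega⟩
    · have h2 : i ≠ ⟨n - 2, by omega⟩ := by
        subst h1; simp only [ne_eq, Fin.mk.injEq]; omega
      rw [Pi.single_eq_of_ne h2]; ring
    · rw [Pi.single_eq_of_ne h1]; ring
  have z : ∀ (j k : Fin n), k.val ≠ j.val → (Pi.single k 1 : Fin n → K) j = 0 := by
    intro j k hjk
    exact Pi.single_eq_of_ne (fun hh => hjk (by rw [hh])) _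
  simp only [Pi.add_apply, key, mul_add, Finset.sum_add_distrib, add_smul,
    z ⟨0, by omega⟩ ⟨n - 1, by omega⟩ n0, z ⟨0, by omega⟩ ⟨n - 2, by omega⟩ n2,
    zero_mul, zero_add] at hA hB hAB
  rw [← hA, ← hB] at hAB
  have eA : ∀ k : Fin n, ∑ i, (Pi.single k 1 : Fin n → K) i • e i = e k := by
    intro k
    simp [Pi.single_apply]
  rw [eA, eA] at hAB
  rw [bil, QuadraticMap.associated_apply, vecA, vecB, hAB]
  simp

end Field

end SpinDecomposition

end

/-!
Write `W` for the quadratic space and `e₁, e₂` for the hyperbolic pair in the adapted basis, which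
is orthogonal to `a` and `b`.

*Surjectivity of `ψ` on rational points.* Given `g`, take `s = g(a)`. What remains is to find `t`
orthogonal to `a` and `s` with `f(t) = f(b)`, and this can be done for every vector `s`
(`exists_isOrtho_isOrtho_form_eq`): if `s` is not orthogonal to `e₁` or to `e₂`, move `b` along
that isotropic vector until it is orthogonal to `s`; otherwise the plane spanned by `e₁` and `e₂`
is orthogonal to both `a` and `s`, and it represents every scalar.

*Surjectivity of `φ` on rational points.* The key is a transitivity statement
(`exists_mem_stab_vectorRep_eq`): if `t` is orthogonal to `a` and `f(t) = f(b) ≠ 0`, then some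
element of the spin group fixes `a` and sends `b` to `t`. As `f(b - t) + f(b + t) = 4 f(b)`, one of
`b - t` and `b + t` is anisotropic, and the reflection in it sends `b` to `t` or to `-t`. The
determinant and the spinor norm are corrected by reflections in vectors of prescribed norm in the
hyperbolic plane, which fix `a` and `b`, and the sign of `t` by the reflection in `b`. By symmetry
the same holds with `a` and `b` interchanged. Now let `(g, s, t) ∈ Z`. There are `x ∈ G(a)` with
`x(b) = t`, then `y ∈ G(b)` with `y(a) = x⁻¹(s)`, then `z ∈ G(a)` with `z(b) = (xy)⁻¹g(b)`; each of
the three orthogonality relations defining `Z` is what one of these steps requires. Finally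
`u = (xyz)⁻¹g` fixes `b`.
-/

open scoped Pointwise

namespace SpinDecomposition

/-! ### Hyperbolic pairs and the fibres of `ψ` -/

section HyperbolicPair

open QuadraticMap

variable {K : Type*} [Field K] {W : Type*} [AddCommGroup W] [Module K W] {f : QuadraticForm K W}

theorem isOrtho_iff_polar_eq_zero {x y : W} : f.IsOrtho x y ↔ polar f x y = 0 :=
  (isOrtho_polarBilin (Q := f)).symm

theorem form_add_smul_of_isOrtho {v w : W} (h : f.IsOrtho v w) (c : K) :
    f (v + c • w) = f v + c * c * f w := by
  have h1 := polar_smul_right f c v w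
  rw [h.polar_eq_zero, smul_zero, polar, QuadraticMap.map_smul, smul_eq_mul] at h1
  linear_combination h1

theorem isOrtho_add_smul_left {v w x : W} (hv : f.IsOrtho v x) (hw : f.IsOrtho w x) (c : K) :
    f.IsOrtho (v + c • w) x := by
  rw [isOrtho_iff_polar_eq_zero] at *
  rw [polar_add_left, polar_smul_left, hv, hw, smul_zero, add_zero]

/-- A hyperbolic pair represents the scalar `c` by the vector `p + c q`. -/
theorem form_hyperbolic {p q : W} (hp : f p = 0) (hq : f q = 0) (hpq : polar f p q = 1) (c : K) :
    f (p + c • q) = c := by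
  have h1 := polar_smul_right f c p q
  rw [hpq, polar, QuadraticMap.map_smul, hp, hq] at h1
  simpa using h1

/-- Moving `b` along an isotropic vector `p` orthogonal to `a` and `b` makes it orthogonal to any
given `s` that is not orthogonal to `p`, and changes neither its norm nor its orthogonality
to `a`. -/
theorem exists_isOrtho_of_polar_ne_zero {a b p s : W} (hba : f.IsOrtho b a) (hp : f p = 0)
    (hpa : f.IsOrtho p a) (hpb : f.IsOrtho p b) (hps : polar f p s ≠ 0) :
    ∃ t, f.IsOrtho t a ∧ f.IsOrtho t s ∧ f t = f b := by
  refine ⟨b + (-(polar f b s / polar f p s)) • p, isOrtho_add_smul_left hba hpa _, ?_, ?_⟩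
  · rw [isOrtho_iff_polar_eq_zero, polar_add_left, polar_smul_left, smul_eq_mul]
    field_simp
    ring
  · rw [form_add_smul_of_isOrtho hpb.symm, hp, mul_zero, add_zero]

/-- If `a ⟂ b` and a hyperbolic pair `p, q` is orthogonal to both, then the orthogonal complement of
`a` and an arbitrary vector `s` represents `f(b)`. -/
theorem exists_isOrtho_isOrtho_form_eq {a b p q : W} (hba : f.IsOrtho b a)
    (hp : f p = 0) (hq : f q = 0) (hpq : polar f p q = 1)
    (hpa : f.IsOrtho p a) (hpb : f.IsOrtho p b) (hqa : f.IsOrtho q a) (hqb : f.IsOrtho q b)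
    (s : W) : ∃ t, f.IsOrtho t a ∧ f.IsOrtho t s ∧ f t = f b := by
  by_cases hps : polar f p s = 0
  · by_cases hqs : polar f q s = 0
    · exact ⟨p + f b • q, isOrtho_add_smul_left hpa hqa _,
        isOrtho_add_smul_left (isOrtho_iff_polar_eq_zero.2 hps) (isOrtho_iff_polar_eq_zero.2 hqs) _,
        form_hyperbolic hp hq hpq _⟩
    · exact exists_isOrtho_of_polar_ne_zero hba hq hqa hqb hqs
  · exact exists_isOrtho_of_polar_ne_zero hba hp hpa hpb hps

end HyperbolicPair

/-! ### Transitivity of stabilizers and the fibres of `φ` -/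

section Transitivity

open CliffordAlgebra QuadraticMap

variable {K : Type*} [Field K] {W : Type*} [AddCommGroup W] [Module K W] {f : QuadraticForm K W}

theorem ι_mem_map_lipschitzGroup {v : W} (hv : f v ≠ 0) :
    ι f v ∈ (lipschitzGroup f).toSubmonoid.map (Units.coeHom (CliffordAlgebra f)) := by
  obtain ⟨x, hx⟩ := isUnit_ι_of_isUnit f (isUnit_iff_ne_zero.2 hv)
  exact ⟨x, Subgroup.subset_closure ⟨v, hx.symm⟩, hx⟩

/-- A product of two vectors whose norms are inverse to each other lies in the spin group. -/
theorem ι_mul_ι_mem_spinGroup {v w : W} (h : f v * f w = 1) : ι f v * ι f w ∈ spinGroup f := by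
  have hv : f v ≠ 0 := left_ne_zero_of_mul_eq_one h
  have hw : f w ≠ 0 := right_ne_zero_of_mul_eq_one h
  have key : ∀ x y : W, f x * f y = 1 →
      ι f x * ι f y * (ι f y * ι f x) = 1 := fun x y hxy => by
    rw [mul_assoc, ← mul_assoc (ι f y), ι_sq_scalar, Algebra.commutes, ← mul_assoc, ι_sq_scalar,
      ← map_mul, hxy, map_one]
  refine ⟨⟨mul_mem (ι_mem_map_lipschitzGroup hv) (ι_mem_map_lipschitzGroup hw), ?_⟩,
    ι_mul_ι_mem_evenOdd_zero f v w⟩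
  rw [SetLike.mem_coe, Unitary.mem_iff, star_mul, star_ι, star_ι, neg_mul_neg]
  exact ⟨key w v (by rw [mul_comm, h]), key v w h⟩

variable [Invertible (2 : K)]

theorem bil_eq_zero_iff {x y : W} : bil f x y = 0 ↔ f.IsOrtho x y :=
  QuadraticMap.associated_isOrtho

theorem IsOrtho.vectorRep_iff {x y : W} (g : spinGroup f) :
    f.IsOrtho (vectorRep f g x) (vectorRep f g y) ↔ f.IsOrtho x y := by
  rw [← bil_eq_zero_iff, ← bil_eq_zero_iff, bil_vectorRep]

theorem vectorRep_inv_vectorRep (g : spinGroup f) (w : W) :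
    vectorRep f g⁻¹ (vectorRep f g w) = w := by
  rw [← Module.End.mul_apply, ← map_mul, inv_mul_cancel, map_one, Module.End.one_apply]

theorem vectorRep_vectorRep_inv (g : spinGroup f) (w : W) :
    vectorRep f g (vectorRep f g⁻¹ w) = w := by
  rw [← Module.End.mul_apply, ← map_mul, mul_inv_cancel, map_one, Module.End.one_apply]

theorem vectorRep_eq_of_mul_ι_eq {g : spinGroup f} {u u' : W}
    (h : (g : CliffordAlgebra f) * ι f u = ι f u' * g) : vectorRep f g u = u' := by
  apply ι_injective f
  have e : ι f (vectorRep f g u) = _ := ι_spinApply f g u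
  have hg : (g : CliffordAlgebra f) * ((g⁻¹ : spinGroup f) : CliffordAlgebra f) = 1 := by
    rw [← Submonoid.coe_mul, mul_inv_cancel, Submonoid.coe_one]
  rw [e, h, mul_assoc, hg, mul_one]

/-- The element `v w` of the spin group, for vectors `v` and `w` with `f(v) f(w) = 1`. -/
def spinPair (v w : W) (h : f v * f w = 1) : spinGroup f :=
  ⟨ι f v * ι f w, ι_mul_ι_mem_spinGroup h⟩

/-- If `w ⟂ u`, then `v w` acts on `u` as minus conjugation by `v`. -/
theorem vectorRep_spinPair {v w u u' : W} (h : f v * f w = 1) (hwu : f.IsOrtho w u)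
    (hv : ι f v * ι f u = -(ι f u' * ι f v)) : vectorRep f (spinPair v w h) u = u' := by
  apply vectorRep_eq_of_mul_ι_eq
  change ι f v * ι f w * ι f u = ι f u' * (ι f v * ι f w)
  rw [mul_assoc, ι_mul_ι_comm_of_isOrtho hwu, mul_neg, ← mul_assoc, hv, neg_mul, neg_neg,
    mul_assoc]

/-- If the orthogonal complement of `a` and `b` represents all scalars, then `G(a)` acts
transitively on the vectors orthogonal to `a` with the same nonzero norm as `b`. -/
theorem exists_mem_stab_vectorRep_eq {a b t : W} (hab : f.IsOrtho a b) (hb : f b ≠ 0)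
    (huniv : ∀ c, ∃ v, f v = c ∧ f.IsOrtho v a ∧ f.IsOrtho v b)
    (hta : f.IsOrtho t a) (ht : f t = f b) :
    ∃ x ∈ stab f a, vectorRep f x b = t := by
  have hba : ι f b * ι f a = -(ι f a * ι f b) := ι_mul_ι_comm_of_isOrtho hab.symm
  have hta' : ι f t * ι f a = -(ι f a * ι f t) := ι_mul_ι_comm_of_isOrtho hta
  by_cases hsub : f (b - t) = 0
  · have hsum : f (b + t) + f (b - t) = 4 * f b := by
      have h1 := polar_neg_right f b t
      rw [polar, polar, QuadraticMap.map_neg, ← sub_eq_add_neg, ht] at h1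
      linear_combination h1
    have hadd : f (b + t) ≠ 0 := by
      rw [hsub, add_zero] at hsum
      rw [hsum]
      have h4 : (4 : K) = 2 * 2 := by norm_num
      rw [h4]
      exact mul_ne_zero (mul_ne_zero (Invertible.ne_zero 2) (Invertible.ne_zero 2)) hb
    obtain ⟨v, hv, hva, hvb⟩ := huniv (f (b + t))⁻¹
    obtain ⟨w, hw, hwa, hwb⟩ := huniv (f b)⁻¹
    have h1 : f (b + t) * f v = 1 := by rw [hv, mul_inv_cancel₀ hadd]
    have h2 : f b * f w = 1 := by rw [hw, mul_inv_cancel₀ hb]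
    -- `b w` sends `b` to `-b`, and `(b + t) v` sends `b` to `-t`.
    refine ⟨spinPair _ _ h1 * spinPair _ _ h2, ?_, ?_⟩
    · rw [mem_stab, map_mul, Module.End.mul_apply, vectorRep_spinPair h2 hwa hba]
      apply vectorRep_spinPair h1 hva
      rw [map_add, add_mul, hba, hta', mul_add, neg_add]
    · rw [map_mul, Module.End.mul_apply, vectorRep_spinPair (u' := -b) h2 hwb (by simp), map_neg,
        vectorRep_spinPair (u' := -t) h1 hvb, neg_neg]
      rw [map_add, map_neg, add_mul, neg_mul, neg_neg, mul_add, ι_sq_scalar, ι_sq_scalar, ht,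
        add_comm]
  · obtain ⟨v, hv, hva, hvb⟩ := huniv (f (b - t))⁻¹
    have h1 : f (b - t) * f v = 1 := by rw [hv, mul_inv_cancel₀ hsub]
    refine ⟨spinPair _ _ h1, ?_, ?_⟩
    · rw [mem_stab]
      apply vectorRep_spinPair h1 hva
      rw [map_sub, sub_mul, hba, hta', mul_sub]
      abel
    · apply vectorRep_spinPair h1 hvb
      rw [map_sub, sub_mul, mul_sub, ι_sq_scalar, ι_sq_scalar, ht, neg_sub]

/-- `φ` is surjective on rational points as soon as the orthogonal complement of `a` and `b`
represents all scalars. -/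
theorem phi_surjective {a b : W} (hab : bil f a b = 0) (ha : f a ≠ 0) (hb : f b ≠ 0)
    (huniv : ∀ c, ∃ v, f v = c ∧ f.IsOrtho v a ∧ f.IsOrtho v b) :
    Function.Surjective (phi f a b hab) := by
  rintro ⟨⟨g, s, t⟩, ⟨hs, hsg⟩, hta, ht, hst⟩
  simp only [X, Set.mem_ofPred_eq] at hs
  simp only at hsg hta ht hst
  have hab' : f.IsOrtho a b := bil_eq_zero_iff.1 hab
  rw [bil_eq_zero_iff] at hsg hta hst
  have huniv' : ∀ c, ∃ v, f v = c ∧ f.IsOrtho v b ∧ f.IsOrtho v a := fun c =>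
    let ⟨v, h1, h2, h3⟩ := huniv c
    ⟨v, h1, h3, h2⟩
  obtain ⟨x, hx, hxb⟩ := exists_mem_stab_vectorRep_eq hab' hb huniv hta ht
  obtain ⟨y, hy, hya⟩ := exists_mem_stab_vectorRep_eq (t := vectorRep f x⁻¹ s) hab'.symm ha huniv'
    (by rw [← IsOrtho.vectorRep_iff x, vectorRep_vectorRep_inv, hxb]; exact hst)
    (by rw [form_vectorRep, hs])
  have hxya : vectorRep f (x * y) a = s := by
    rw [map_mul, Module.End.mul_apply, hya, vectorRep_vectorRep_inv]
  have hxyb : vectorRep f (x * y) b = t := by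
    rw [map_mul, Module.End.mul_apply, mem_stab.1 hy, hxb]
  obtain ⟨z, hz, hzb⟩ := exists_mem_stab_vectorRep_eq
    (t := vectorRep f (x * y)⁻¹ (vectorRep f g b)) hab' hb huniv
    (by rw [← IsOrtho.vectorRep_iff (x * y), vectorRep_vectorRep_inv, hxya]; exact hsg.symm)
    (by rw [form_vectorRep, form_vectorRep])
  have hu : (x * y * z)⁻¹ * g ∈ stab f b := by
    rw [mem_stab, mul_inv_rev, mul_assoc, map_mul, Module.End.mul_apply, map_mul,
      Module.End.mul_apply, ← hzb, vectorRep_inv_vectorRep]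
  refine ⟨(⟨x, hx⟩, ⟨y, hy⟩, ⟨z, hz⟩, ⟨_, hu⟩), Subtype.ext ?_⟩
  simp only [phi, mu, hxya, hxyb, mul_inv_cancel_left]

end Transitivity

/-! ### The form in an adapted basis -/

section AdaptedBasis

open QuadraticMap

variable {K : Type*} [Field K] {W : Type*} [AddCommGroup W] [Module K W]
  {n : ℕ} {hn : 5 ≤ n} {f : QuadraticForm K W} {e : Module.Basis (Fin n) K W} {α : Fin n → K}

theorem IsAdaptedBasis.polar_eq (h : IsAdaptedBasis hn f e α) (x y : Fin n → K) :
    polar f (∑ i, x i • e i) (∑ i, y i • e i) =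
      x ⟨0, by omega⟩ * y ⟨1, by omega⟩ + x ⟨1, by omega⟩ * y ⟨0, by omega⟩ +
      ∑ i ∈ Finset.univ.filter (fun i : Fin n => 2 ≤ i.val), 2 * α i * x i * y i := by
  have h3 := h (x + y)
  simp only [Pi.add_apply, add_smul, Finset.sum_add_distrib] at h3
  rw [polar, h3, h x, h y]
  have hs : ∑ i ∈ Finset.univ.filter (fun i : Fin n => 2 ≤ i.val), 2 * α i * x i * y i =
      ∑ i ∈ Finset.univ.filter (fun i : Fin n => 2 ≤ i.val), α i * (x i + y i) ^ 2 -
      ∑ i ∈ Finset.univ.filter (fun i : Fin n => 2 ≤ i.val), α i * x i ^ 2 -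
      ∑ i ∈ Finset.univ.filter (fun i : Fin n => 2 ≤ i.val), α i * y i ^ 2 := by
    rw [← Finset.sum_sub_distrib, ← Finset.sum_sub_distrib]
    exact Finset.sum_congr rfl fun i _ => by ring
  rw [hs]
  ring

theorem sum_single_smul_basis (k : Fin n) : ∑ i, (Pi.single k 1 : Fin n → K) i • e i = e k := by
  simp [Pi.single_apply]

theorem IsAdaptedBasis.polar_basis (h : IsAdaptedBasis hn f e α) (j k : Fin n) :
    polar f (e j) (e k) =
      if j = k then (if 2 ≤ j.val then 2 * α j else 0)
      else if j.val < 2 ∧ k.val < 2 then 1 else 0 := by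
  have h1 := h.polar_eq (Pi.single j 1) (Pi.single k 1)
  rw [sum_single_smul_basis, sum_single_smul_basis] at h1
  rw [h1]
  obtain ⟨j, hj⟩ := j
  obtain ⟨k, hk⟩ := k
  simp only [Pi.single_apply, Fin.ext_iff, Finset.sum_filter, mul_ite, mul_one, mul_zero]
  have hs : (∑ i : Fin n, if 2 ≤ i.val then
      (if i.val = k then (if i.val = j then 2 * α i else 0) else 0) else 0) =
      if j = k ∧ 2 ≤ j then 2 * α ⟨j, hj⟩ else 0 := by
    rw [Finset.sum_eq_single (⟨j, hj⟩ : Fin n)]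
    · simp only [if_true]
      split_ifs <;> first | rfl | omega
    · intro i _ hi
      have : i.val ≠ j := fun hh => hi (Fin.ext hh)
      simp [this]
    · simp
  rw [hs]
  split_ifs <;> first | omega | simp_all

theorem IsAdaptedBasis.isOrtho_basis (h : IsAdaptedBasis hn f e α) {j k : Fin n}
    (hjk : j ≠ k) (hk : 2 ≤ k.val) : f.IsOrtho (e j) (e k) := by
  rw [isOrtho_iff_polar_eq_zero, h.polar_basis, if_neg hjk, if_neg (by omega)]

variable [Invertible (2 : K)]

theorem IsAdaptedBasis.form_basis_of_lt (h : IsAdaptedBasis hn f e α) {k : Fin n}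
    (hk : k.val < 2) : f (e k) = 0 := by
  have h1 := h.polar_basis k k
  rw [polar_self, if_pos rfl, if_neg (by omega), two_nsmul, ← two_mul] at h1
  exact (mul_eq_zero.1 h1).resolve_left (Invertible.ne_zero 2)

/-- Were the diagonal vector `eₖ` isotropic, it would lie in the radical. -/
theorem IsAdaptedBasis.form_basis_ne_zero (h : IsAdaptedBasis hn f e α)
    (hf : (QuadraticMap.associated f).Nondegenerate) {k : Fin n} (hk : 2 ≤ k.val) :
    f (e k) ≠ 0 := by
  intro h0
  apply e.ne_zero k
  apply hf.2
  intro v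
  have : (QuadraticMap.associated f).flip (e k) = 0 := by
    apply e.ext
    intro j
    change bil f (e j) (e k) = 0
    rw [bil_eq_zero_iff]
    by_cases hjk : j = k
    · rw [hjk, isOrtho_iff_polar_eq_zero, polar_self, h0, smul_zero]
    · exact h.isOrtho_basis hjk hk
  exact LinearMap.congr_fun this v

end AdaptedBasis

end SpinDecomposition

theorem mainTheorem7 {K : Type*} [Field K] [Invertible (2 : K)]
    {W : Type*} [AddCommGroup W] [Module K W] (n : ℕ) (hn : 5 ≤ n)
    (f : QuadraticForm K W) (hf : (QuadraticMap.associated f).Nondegenerate)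
    (hiso : ¬ f.Anisotropic)
    (e : Module.Basis (Fin n) K W) (α : Fin n → K)
    (he : SpinDecomposition.IsAdaptedBasis hn f e α) :
    let a : W := SpinDecomposition.vecA hn e
    let b : W := SpinDecomposition.vecB hn e
    (∀ g : spinGroup f, (SpinDecomposition.psi f a b ⁻¹' {g}).Nonempty) ∧
      (∀ ζ : SpinDecomposition.Z f a b,
        (SpinDecomposition.phi f a b he.ortho ⁻¹' {ζ}).Nonempty) ∧
      Set.range (SpinDecomposition.mu f a b) = Set.univ ∧
      (SpinDecomposition.stab f a : Set (spinGroup f)) *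
        (SpinDecomposition.stab f b : Set (spinGroup f)) *
        (SpinDecomposition.stab f a : Set (spinGroup f)) *
        (SpinDecomposition.stab f b : Set (spinGroup f)) = Set.univ := by
  intro a b
  open SpinDecomposition in
  let p : W := e ⟨0, by omega⟩
  let q : W := e ⟨1, by omega⟩
  have hp : f p = 0 := he.form_basis_of_lt (by simp)
  have hq : f q = 0 := he.form_basis_of_lt (by simp)
  have hpq : QuadraticMap.polar f p q = 1 := by
    rw [he.polar_basis, if_neg (by simp), if_pos (by simp)]
  have hpa : f.IsOrtho p a := he.isOrtho_basis (by simp; omega) (by simp; omega)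
  have hqa : f.IsOrtho q a := he.isOrtho_basis (by simp; omega) (by simp; omega)
  have hpb : f.IsOrtho p b := he.isOrtho_basis (by simp; omega) (by simp; omega)
  have hqb : f.IsOrtho q b := he.isOrtho_basis (by simp; omega) (by simp; omega)
  have ha : f a ≠ 0 := he.form_basis_ne_zero hf (by simp; omega)
  have hb : f b ≠ 0 := he.form_basis_ne_zero hf (by simp; omega)
  have hab : f.IsOrtho a b := SpinDecomposition.bil_eq_zero_iff.1 he.ortho
  have hpsi : Function.Surjective (psi f a b) := fun g => by
    obtain ⟨t, hta, hts, ht⟩ := exists_isOrtho_isOrtho_form_eq hab.symm hp hq hpq hpa hpb hqa hqb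
      (vectorRep f g a)
    exact ⟨⟨(g, vectorRep f g a, t),
      ⟨form_vectorRep f g a, bil_eq_zero_iff.2 ((IsOrtho.vectorRep_iff g).2 hab)⟩,
      bil_eq_zero_iff.2 hta, ht, bil_eq_zero_iff.2 hts.symm⟩, rfl⟩
  have hphi : Function.Surjective (phi f a b he.ortho) := phi_surjective he.ortho ha hb fun c =>
    ⟨p + c • q, form_hyperbolic hp hq hpq c, isOrtho_add_smul_left hpa hqa c,
      isOrtho_add_smul_left hpb hqb c⟩
  have hmu : Function.Surjective (mu f a b) := by
    rw [mu_eq_psi_comp_phi f a b he.ortho]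
    exact hpsi.comp hphi
  refine ⟨hpsi, hphi, hmu.range_eq, Set.eq_univ_of_forall fun g => ?_⟩
  obtain ⟨⟨x, y, z, u⟩, rfl⟩ := hmu g
  exact Set.mul_mem_mul (Set.mul_mem_mul (Set.mul_mem_mul x.2 y.2) z.2) u.2
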